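/- A set cover instance with parameters $n,m$ is a sequence $\mathcal S=(S_1,\dots,S_m)$ of subsets of $[n]$ whose union is $[n]$; $\mathrm{opt}(\mathcal S)$ denotes the smallest number of sets of $\mathcal S$ whose union is $[n]$. A deterministic single-pass streaming algorithm for such instances has a memory whose content is a bit string (with a fixed initial content); it reads $S_1,\dots,S_m$ one by one in this order, replaces its memory content, on the arrival of each set, by a function of the current content and of the arriving set, and after the last set outputs a real number that is a function of the memory content. (There is no restriction on these functions; they may depend on $n$ and $m$.) Its space is the maximal number of bits it stores at any moment of the stream, over all instances with parameters $n,m$. The algorithm $\alpha$-estimates the set cover problem (for the parameters $n,m$) if on every instance $\mathcal S$ with these parameters its output lies in $[\mathrm{opt}(\mathcal S),\ \alpha\cdot \mathrm{opt}(\mathcal S)]$. Theorem. There is an absolute constant $c>0$ such that the following holds. Let $\alpha=\alpha(n)\ge 1$ be real numbers and $m=m(n)$ natural numbers with $$\alpha=o\!\left(\sqrt{n/\log n}\right),\qquad m=O(n^{k})\ \text{for some constant } k,\qquad m=\Omega(\alpha\log n).$$ Then for all sufficiently large $n$, every deterministic single-pass streaming algorithm that $\alpha(n)$-estimates the set cover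 problem with universe $[n]$ and $m(n)$ sets uses at least $c\, m n/\alpha$ bits of space. In other words, deterministic single-pass $\alpha$-estimation of the set cover size requires $\Omega(mn/\alpha)$ bits of space. -/

import Mathlib

open Filter Asymptotics

namespace SetCoverStream

/-- A set cover input with universe `[n]` and `m` sets, in order of arrival (repetitions allowed). -/
abbrev Family (n m : ℕ) := Fin m → Finset (Fin n)

/-- The sets with index in `I` cover the whole universe. -/
def IsCover {n m : ℕ} (S : Family n m) (I : Finset (Fin m)) : Prop :=
  I.biUnion S = Finset.univ

/-- `S` is a (feasible) set cover instance: some subcollection of the sets covers the universe. -/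
def IsInstance {n m : ℕ} (S : Family n m) : Prop :=
  ∃ I : Finset (Fin m), IsCover S I

/-- The cardinality of a minimum set cover. It is only used for feasible instances. -/
noncomputable def opt {n m : ℕ} (S : Family n m) : ℕ :=
  sInf {k : ℕ | ∃ I : Finset (Fin m), IsCover S I ∧ I.card = k}

/-- A deterministic single-pass streaming algorithm on streams of subsets of `[n]`. Its memory is
a bit string, updated by an arbitrary function of the current memory and the arriving set; at the
end of the stream, it outputs a real number computed from its memory. There is no restriction on
the computations between two arrivals. -/
structure Algorithm (n : ℕ) where
  init : List Bool
  step : List Bool → Finset (Fin n) → List Bool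
  output : List Bool → ℝ

/-- The content of the memory after reading the first `i` sets of the stream `S`. -/
def Algorithm.memory {n m : ℕ} (A : Algorithm n) (S : Family n m) (i : ℕ) : List Bool :=
  ((List.ofFn S).take i).foldl A.step A.init

/-- The value output after the whole stream has been read. -/
def Algorithm.result {n m : ℕ} (A : Algorithm n) (S : Family n m) : ℝ :=
  A.output (A.memory S m)

/-- `A` is an `α`-estimation algorithm for the set cover problem with `m` sets: on every instance,
its output lies in `[opt, α * opt]`. -/
def Algorithm.Estimates {n : ℕ} (A : Algorithm n) (m : ℕ) (α : ℝ) : Prop :=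
  ∀ S : Family n m, IsInstance S → A.result S ∈ Set.Icc (opt S : ℝ) (α * (opt S : ℝ))

/-- On every instance with `m` sets, `A` stores at most `s` bits at each moment of the stream. -/
def Algorithm.UsesAtMost {n : ℕ} (A : Algorithm n) (m s : ℕ) : Prop :=
  ∀ S : Family n m, IsInstance S → ∀ i ≤ m, (A.memory S i).length ≤ s

end SetCoverStream

namespace SetCoverStream

/-! Place `2 * r * w` disjoint blocks of size `64 * r` in `[n]`, in `2 * r` groups of `w`, with `r =
⌊2α⌋`. Stream `M` transversals of the blocks, then the complement of a transversal `f` and the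
pieces of `f` in each group. If `f` was streamed, `opt ≤ 2`. Otherwise a cover by `r` sets has
pieces handling at most half of the blocks, so its transversals must agree with `f` on the other
half (`lt_opt_stream`). As `2α < r + 1`, sequences with equal memory consist of functions close to
each other's transversals. At most a `4 ^ (-r * w)` fraction of functions is close to a given
sequence (`card_closeFunctions_mul_le`), so a memory state serves at most a `4 ^ (-r * w * M)`
fraction of sequences. Pigeonhole gives `2 * r * w * M ≤ s + 1`, of order `mn/α`. -/

/-! ### Counting bounds -/

/-- Pigeonhole for bit strings of bounded length. -/
theorem exists_large_fiber_of_length_le {β : Type*} [Fintype β] (F : β → List Bool) (s : ℕ)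
    (hF : ∀ x, (F x).length ≤ s) (hβ : 0 < Fintype.card β) :
    ∃ l, Fintype.card β ≤ 2 ^ (s + 1) * (Finset.univ.filter fun x => F x = l).card := by
  classical
  set L : Finset (List Bool) := (Finset.range (s + 1)).biUnion fun k =>
    Finset.univ.image fun v : Fin k → Bool => List.ofFn v with hL
  have hmaps : ∀ x ∈ (Finset.univ : Finset β), F x ∈ L := by
    intro x _
    simp only [hL, Finset.mem_biUnion, Finset.mem_range, Finset.mem_image, Finset.mem_univ,
      true_and]
    exact ⟨(F x).length, Nat.lt_succ_of_le (hF x), (F x).get, List.ofFn_get _⟩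
  have hcard : L.card ≤ 2 ^ (s + 1) := by
    calc L.card ≤ ∑ k ∈ Finset.range (s + 1),
          (Finset.univ.image fun v : Fin k → Bool => List.ofFn v).card := Finset.card_biUnion_le
      _ ≤ ∑ k ∈ Finset.range (s + 1), 2 ^ k := by
          refine Finset.sum_le_sum fun k _ => Finset.card_image_le.trans ?_
          simp
      _ ≤ 2 ^ (s + 1) := by
          have := Nat.geomSum_eq (le_refl 2) (s + 1)
          rw [this]; simp
  by_contra! hcon
  have hLne : L.Nonempty := by
    obtain ⟨x⟩ := Fintype.card_pos_iff.mp hβ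
    exact ⟨_, hmaps x (Finset.mem_univ x)⟩
  have hsum := Finset.card_eq_sum_card_fiberwise hmaps
  have : 2 ^ (s + 1) * Fintype.card β < 2 ^ (s + 1) * Fintype.card β := by
    calc 2 ^ (s + 1) * Fintype.card β
        = ∑ l ∈ L, 2 ^ (s + 1) * (Finset.univ.filter fun x => F x = l).card := by
          rw [← Finset.card_univ, hsum, Finset.mul_sum]
      _ < ∑ l ∈ L, Fintype.card β := Finset.sum_lt_sum_of_nonempty hLne fun l _ => hcon l
      _ = L.card * Fintype.card β := by rw [Finset.sum_const, smul_eq_mul]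
      _ ≤ 2 ^ (s + 1) * Fintype.card β := Nat.mul_le_mul_right _ hcard
  exact lt_irrefl _ this

/-- Few functions meet a prescribed sequence of small sets in `h` positions. -/
theorem card_filter_mem_le {ι β : Type*} [Fintype ι] [DecidableEq ι] [Fintype β] [DecidableEq β]
    (P : ι → Finset β) (r h : ℕ) (hP : ∀ j, (P j).card ≤ r) :
    (Finset.univ.filter fun f : ι → β => h ≤ (Finset.univ.filter fun j => f j ∈ P j).card).card ≤
      2 ^ Fintype.card ι * (r ^ h * Fintype.card β ^ (Fintype.card ι - h)) := by
  have hsub : (Finset.univ.filter fun f : ι → β =>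
      h ≤ (Finset.univ.filter fun j => f j ∈ P j).card) ⊆
      -- Fix `h` of the hit positions: each leaves at most `r` values, the others are free.
      (Finset.powersetCard h (Finset.univ : Finset ι)).biUnion fun H =>
        Fintype.piFinset fun j => if j ∈ H then P j else Finset.univ := by
    intro f hf
    obtain ⟨H, hH, hHc⟩ := Finset.exists_subset_card_eq (Finset.mem_filter.mp hf).2
    refine Finset.mem_biUnion.mpr ⟨H, Finset.mem_powersetCard.mpr ⟨H.subset_univ, hHc⟩, ?_⟩
    refine Fintype.mem_piFinset.mpr fun j => ?_
    split_ifs with hj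
    · exact (Finset.mem_filter.mp (hH hj)).2
    · exact Finset.mem_univ _
  have hterm : ∀ H ∈ Finset.powersetCard h (Finset.univ : Finset ι),
      (Fintype.piFinset fun j => if j ∈ H then P j else Finset.univ).card ≤
        r ^ h * Fintype.card β ^ (Fintype.card ι - h) := by
    intro H hH
    have hHc := (Finset.mem_powersetCard.mp hH).2
    rw [Fintype.card_piFinset, ← Finset.prod_mul_prod_compl H]
    refine Nat.mul_le_mul ?_ ?_
    · rw [← hHc]
      refine Finset.prod_le_pow_card _ _ _ fun j hj => ?_
      simpa [hj] using hP j
    · rw [← hHc, ← Finset.card_compl]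
      refine Finset.prod_le_pow_card _ _ _ fun j hj => ?_
      simp [Finset.mem_compl.mp hj]
  calc _ ≤ _ := Finset.card_le_card hsub
    _ ≤ _ := Finset.card_biUnion_le_card_mul _ _ _ hterm
    _ ≤ _ := by
      refine Nat.mul_le_mul_right _ ?_
      rw [Finset.card_powersetCard, Finset.card_univ]
      exact Nat.choose_le_two_pow _ _

/-! ### Covers and memory of concatenated streams -/

theorem opt_le {n m : ℕ} {S : Family n m} {I : Finset (Fin m)} (h : IsCover S I) :
    opt S ≤ I.card :=
  Nat.sInf_le ⟨I, h, rfl⟩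

theorem lt_opt {n m r : ℕ} {S : Family n m} (hS : IsInstance S)
    (h : ∀ I : Finset (Fin m), I.card ≤ r → ¬ IsCover S I) : r < opt S := by
  obtain ⟨I₀, hI₀⟩ := hS
  obtain ⟨I, hI, hc⟩ := Nat.sInf_mem
    (s := {k : ℕ | ∃ I : Finset (Fin m), IsCover S I ∧ I.card = k}) ⟨_, I₀, hI₀, rfl⟩
  by_contra! hle
  exact h I (hc.trans_le hle) hI

theorem isCover_iff {n m : ℕ} {S : Family n m} {I : Finset (Fin m)} :
    IsCover S I ↔ ∀ x, ∃ i ∈ I, x ∈ S i := by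
  simp [IsCover, Finset.eq_univ_iff_forall]

theorem memory_append_left {n M p : ℕ} (A : Algorithm n) (S : Family n M) (B : Family n p) :
    A.memory (Fin.append S B : Family n (M + p)) M = (List.ofFn S).foldl A.step A.init := by
  rw [Algorithm.memory, List.ofFn_fin_append, List.take_left' (by simp)]

theorem result_append {n M p : ℕ} (A : Algorithm n) (S : Family n M) (B : Family n p) :
    A.result (Fin.append S B : Family n (M + p)) =
      A.output ((List.ofFn B).foldl A.step ((List.ofFn S).foldl A.step A.init)) := by
  rw [Algorithm.result, Algorithm.memory, List.take_of_length_le (by simp), List.ofFn_fin_append,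
    List.foldl_append]

/-! ### The hard instances -/

section Construction

variable {n q w b : ℕ}

/-- The transversal picking the element `f j` from each block `j` of a system of disjoint blocks. -/
def transversal (e : (Fin q × Fin w) × Fin b ↪ Fin n) (f : Fin q × Fin w → Fin b) :
    Finset (Fin n) :=
  Finset.univ.image fun j => e (j, f j)

/-- The part of a transversal in the `t`-th group of blocks. -/
def piece (e : (Fin q × Fin w) × Fin b ↪ Fin n) (f : Fin q × Fin w → Fin b) (t : Fin q) :
    Finset (Fin n) :=
  Finset.univ.image fun v => e ((t, v), f (t, v))

/-- The complement of a transversal, followed by its pieces. -/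
def tailSets (e : (Fin q × Fin w) × Fin b ↪ Fin n) (f : Fin q × Fin w → Fin b) :
    Family n (q + 1) :=
  Fin.cons (transversal e f)ᶜ (piece e f)

/-- The stream of transversals `a`, completed by the tail for the transversal `f`. -/
def stream {M : ℕ} (e : (Fin q × Fin w) × Fin b ↪ Fin n) (a : Fin M → Fin q × Fin w → Fin b)
    (f : Fin q × Fin w → Fin b) : Family n (M + (q + 1)) :=
  Fin.append (fun i => transversal e (a i)) (tailSets e f)

variable (e : (Fin q × Fin w) × Fin b ↪ Fin n)

theorem mem_transversal {f : Fin q × Fin w → Fin b} {j : Fin q × Fin w} {x : Fin b} :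
    e (j, x) ∈ transversal e f ↔ f j = x := by
  simp [transversal]

theorem mem_piece {f : Fin q × Fin w → Fin b} {j : Fin q × Fin w} {t : Fin q} {x : Fin b} :
    e (j, x) ∈ piece e f t ↔ t = j.1 ∧ f j = x := by
  obtain ⟨j₁, j₂⟩ := j
  simp only [piece, Finset.mem_image, Finset.mem_univ, true_and, EmbeddingLike.apply_eq_iff_eq,
    Prod.mk.injEq]
  constructor
  · rintro ⟨v, ⟨rfl, rfl⟩, h⟩; exact ⟨rfl, h⟩
  · rintro ⟨rfl, h⟩; exact ⟨j₂, ⟨rfl, rfl⟩, h⟩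

theorem isInstance_stream {M : ℕ} (a : Fin M → Fin q × Fin w → Fin b)
    (f : Fin q × Fin w → Fin b) : IsInstance (stream e a f) := by
  refine ⟨Finset.univ, isCover_iff.mpr fun x => ?_⟩
  by_cases hx : x ∈ transversal e f
  · obtain ⟨j, -, rfl⟩ := Finset.mem_image.mp hx
    refine ⟨Fin.natAdd M j.1.succ, Finset.mem_univ _, ?_⟩
    simp [stream, tailSets, mem_piece]
  · exact ⟨Fin.natAdd M 0, Finset.mem_univ _, by simpa [stream, tailSets] using hx⟩

theorem opt_stream_le_two {M : ℕ} (a : Fin M → Fin q × Fin w → Fin b) (i : Fin M) :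
    opt (stream e a (a i)) ≤ 2 := by
  refine (opt_le (I := {Fin.castAdd (q + 1) i, Fin.natAdd M 0}) ?_).trans Finset.card_le_two
  refine isCover_iff.mpr fun x => ?_
  by_cases hx : x ∈ transversal e (a i)
  · exact ⟨Fin.castAdd (q + 1) i, by simp, by simpa [stream] using hx⟩
  · exact ⟨Fin.natAdd M 0, by simp, by simpa [stream, tailSets] using hx⟩

end Construction

/-- If no `r` transversals of `a` meet `f` in half of the blocks, then more than `r` sets are needed
to cover. -/
theorem lt_opt_stream {n r w b M : ℕ} (e : (Fin (2 * r) × Fin w) × Fin b ↪ Fin n) [NeZero M]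
    (a : Fin M → Fin (2 * r) × Fin w → Fin b) (f : Fin (2 * r) × Fin w → Fin b)
    (hf : ∀ g : Fin r → Fin M,
      (Finset.univ.filter fun j => f j ∈ Finset.univ.image fun t => a (g t) j).card < r * w) :
    r < opt (stream e a f) := by
  classical
  refine lt_opt (isInstance_stream e a f) fun I hI hcov => ?_
  rw [isCover_iff] at hcov
  set J : Finset (Fin M) := Finset.univ.filter fun k => Fin.castAdd (2 * r + 1) k ∈ I with hJ
  set K : Finset (Fin (2 * r)) := Finset.univ.filter fun t => Fin.natAdd M t.succ ∈ I with hK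
  have hJc : J.card ≤ r := by
    refine le_trans ?_ hI
    refine Finset.card_le_card_of_injOn (Fin.castAdd (2 * r + 1)) (fun k hk => ?_)
      ((Fin.castAdd_injective _ _).injOn)
    exact (Finset.mem_filter.mp hk).2
  have hKc : K.card ≤ r := by
    refine le_trans ?_ hI
    refine Finset.card_le_card_of_injOn (fun t => Fin.natAdd M t.succ) (fun k hk => ?_)
      (((Fin.natAdd_injective _ _).comp (Fin.succ_injective _)).injOn)
    exact (Finset.mem_filter.mp hk).2
  -- List `J` by `Fin r`, padding with the index `0`, which exists because `M ≠ 0`.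
  obtain ⟨g, hg⟩ : ∃ g : Fin r → Fin M, ∀ k ∈ J, ∃ t, g t = k := by
    refine ⟨fun t => if h : (t : ℕ) < J.card then J.equivFin.symm ⟨t, h⟩ else 0, fun k hk => ?_⟩
    refine ⟨⟨J.equivFin ⟨k, hk⟩, (J.equivFin ⟨k, hk⟩).2.trans_le hJc⟩, ?_⟩
    simp
  -- The point `e (j, f j)` avoids the complement of `f`, so a transversal agreeing with `f` at `j`
  -- or the piece of the group of `j` covers it.
  have hunion : (Finset.univ : Finset (Fin (2 * r) × Fin w)) ⊆
      (Finset.univ.filter fun j => f j ∈ Finset.univ.image fun t => a (g t) j) ∪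
        K ×ˢ Finset.univ := by
    intro j _
    obtain ⟨i, hi, hx⟩ := hcov (e (j, f j))
    rw [Finset.mem_union]
    induction i using Fin.addCases with
    | left k =>
      left
      obtain ⟨t, rfl⟩ := hg k (Finset.mem_filter.mpr ⟨Finset.mem_univ _, hi⟩)
      simp only [stream, Fin.append_left, mem_transversal] at hx
      exact Finset.mem_filter.mpr ⟨Finset.mem_univ _,
        Finset.mem_image.mpr ⟨t, Finset.mem_univ _, hx⟩⟩
    | right i =>
      right
      simp only [stream, Fin.append_right, tailSets] at hx
      induction i using Fin.cases with
      | zero => simp [mem_transversal] at hx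
      | succ t =>
        simp only [Fin.cons_succ, mem_piece] at hx
        obtain ⟨rfl, -⟩ := hx
        exact Finset.mem_product.mpr
          ⟨Finset.mem_filter.mpr ⟨Finset.mem_univ _, hi⟩, Finset.mem_univ _⟩
  have h1 := (Finset.card_le_card hunion).trans (Finset.card_union_le _ _)
  have h2 := hf g
  have h3 : K.card * w ≤ r * w := Nat.mul_le_mul_right _ hKc
  simp only [Finset.card_univ, Fintype.card_prod, Fintype.card_fin, Finset.card_product] at h1
  rw [mul_assoc] at h1
  omega

/-! ### Close functions and the space bound -/

/-- The functions agreeing in many blocks with some `r` of the functions `a`. -/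
def closeFunctions {M : ℕ} (r w b : ℕ) (a : Fin M → Fin (2 * r) × Fin w → Fin b) :
    Finset (Fin (2 * r) × Fin w → Fin b) :=
  Finset.univ.biUnion fun g : Fin r → Fin M => Finset.univ.filter fun f =>
    r * w ≤ (Finset.univ.filter fun j => f j ∈ Finset.univ.image fun t => a (g t) j).card

/-- Union bound over the `M ^ r` choices of transversals. Block size `64 * r` is chosen since `64 =
4 ^ 3`: one factor `4` pays for these choices, one for the choice of hit positions, and one is the
gain. -/
theorem card_closeFunctions_mul_le {M r w : ℕ} (hM : M ≤ 4 ^ w)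
    (a : Fin M → Fin (2 * r) × Fin w → Fin (64 * r)) :
    (closeFunctions r w (64 * r) a).card * 4 ^ (r * w) ≤
      Fintype.card (Fin (2 * r) × Fin w → Fin (64 * r)) := by
  have h1 : (closeFunctions r w (64 * r) a).card ≤
      M ^ r * (2 ^ (2 * (r * w)) * (r ^ (r * w) * (64 * r) ^ (r * w))) := by
    refine (Finset.card_biUnion_le_card_mul _ _
      (2 ^ (2 * (r * w)) * (r ^ (r * w) * (64 * r) ^ (r * w))) fun g _ => ?_).trans ?_
    · refine (card_filter_mem_le (fun j => Finset.univ.image fun t => a (g t) j) r (r * w)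
        fun j => Finset.card_image_le.trans (by simp)).trans (le_of_eq ?_)
      simp only [Fintype.card_prod, Fintype.card_fin, mul_assoc]
      rw [show 2 * (r * w) - r * w = r * w by omega]
    · simp
  have h2 : M ^ r ≤ 4 ^ (r * w) := by
    calc M ^ r ≤ (4 ^ w) ^ r := Nat.pow_le_pow_left hM r
      _ = 4 ^ (r * w) := by rw [← pow_mul, mul_comm]
  calc (closeFunctions r w (64 * r) a).card * 4 ^ (r * w)
      ≤ 4 ^ (r * w) * (2 ^ (2 * (r * w)) * (r ^ (r * w) * (64 * r) ^ (r * w))) * 4 ^ (r * w) :=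
        Nat.mul_le_mul_right _ (h1.trans (Nat.mul_le_mul_right _ h2))
    _ = (64 * r) ^ (2 * (r * w)) := by
        rw [pow_mul 2 2, pow_mul (64 * r) 2]
        simp only [← mul_pow]
        congr 1
        ring
    _ = _ := by simp [mul_assoc]

theorem space_lower_bound {n M r w s : ℕ} {α : ℝ} (hM0 : 0 < M) (hr : 0 < r) (hM : M ≤ 4 ^ w)
    (hn : 128 * r ^ 2 * w ≤ n) (hrα : 2 * α < r + 1) (hα : 0 ≤ α) (A : Algorithm n)
    (hA : A.Estimates (M + (2 * r + 1)) α) (hs : A.UsesAtMost (M + (2 * r + 1)) s) :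
    2 * (r * w * M) ≤ s + 1 := by
  classical
  have : NeZero M := ⟨hM0.ne'⟩
  have hcard : Fintype.card ((Fin (2 * r) × Fin w) × Fin (64 * r)) ≤ Fintype.card (Fin n) := by
    simp only [Fintype.card_prod, Fintype.card_fin]
    linarith [show 2 * r * w * (64 * r) = 128 * r ^ 2 * w by ring]
  obtain ⟨e⟩ := Function.Embedding.nonempty_of_card_le hcard
  set X := Fin (2 * r) × Fin w → Fin (64 * r)
  have hXpos : 0 < Fintype.card X := by
    simp only [X, Fintype.card_fun, Fintype.card_fin]; positivity
  have hYpos : 0 < Fintype.card (Fin M → X) := by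
    rw [Fintype.card_fun]; positivity
  set F : (Fin M → X) → List Bool := fun a =>
    (List.ofFn fun i => transversal e (a i)).foldl A.step A.init with hF
  have hFlen : ∀ a, (F a).length ≤ s := by
    intro a
    -- Space is bounded only on feasible instances, so the prefix is completed by an arbitrary tail.
    have := hs (stream e a (a 0)) (isInstance_stream e a (a 0)) M (by omega)
    rwa [stream, memory_append_left] at this
  obtain ⟨l, hl⟩ := exists_large_fiber_of_length_le F s hFlen hYpos
  obtain ⟨a, ha⟩ : (Finset.univ.filter fun x => F x = l).Nonempty := by
    rw [← Finset.card_pos]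
    exact Nat.pos_of_mul_pos_left (hYpos.trans_le hl)
  have ha' := (Finset.mem_filter.mp ha).2
  have hsub : (Finset.univ.filter fun x => F x = l) ⊆
      Fintype.piFinset fun _ : Fin M => closeFunctions r w (64 * r) a := by
    intro a₁ ha₁
    have ha₁' := (Finset.mem_filter.mp ha₁).2
    refine Fintype.mem_piFinset.mpr fun i => ?_
    by_contra hfar
    have hfar' : r < opt (stream e a (a₁ i)) := by
      refine lt_opt_stream e a (a₁ i) fun g => ?_
      by_contra! hg
      exact hfar (Finset.mem_biUnion.mpr
        ⟨g, Finset.mem_univ _, Finset.mem_filter.mpr ⟨Finset.mem_univ _, hg⟩⟩)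
    have h1 := (hA _ (isInstance_stream e a₁ (a₁ i))).2
    have h2 := (hA _ (isInstance_stream e a (a₁ i))).1
    -- Equal memory followed by the same tail gives equal output, which is at most `2α < r + 1` on
    -- one stream and at least `r + 1` on the other.
    have h3 : A.result (stream e a₁ (a₁ i)) = A.result (stream e a (a₁ i)) := by
      have := ha₁'.trans ha'.symm
      simp only [hF] at this
      simp only [stream, result_append, this]
    have h4 : (opt (stream e a₁ (a₁ i)) : ℝ) ≤ 2 := by
      exact_mod_cast opt_stream_le_two e a₁ i
    have h5 : (r : ℝ) + 1 ≤ opt (stream e a (a₁ i)) := by exact_mod_cast hfar'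
    nlinarith [mul_le_mul_of_nonneg_left h4 hα]
  have h1 := Finset.card_le_card hsub
  rw [Fintype.card_piFinset_const] at h1
  have h2 := card_closeFunctions_mul_le hM a
  have h3 : Fintype.card X ^ M * 4 ^ (r * w * M) ≤ Fintype.card X ^ M * 2 ^ (s + 1) := by
    calc Fintype.card X ^ M * 4 ^ (r * w * M)
        ≤ 2 ^ (s + 1) * (closeFunctions r w (64 * r) a).card ^ M * 4 ^ (r * w * M) := by
          refine Nat.mul_le_mul_right _ ?_
          calc Fintype.card X ^ M = Fintype.card (Fin M → X) := by simp
            _ ≤ _ := hl.trans (Nat.mul_le_mul_left _ (by simpa using h1))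
      _ = 2 ^ (s + 1) * ((closeFunctions r w (64 * r) a).card * 4 ^ (r * w)) ^ M := by
          rw [mul_pow, ← pow_mul, mul_assoc]
      _ ≤ 2 ^ (s + 1) * Fintype.card X ^ M := Nat.mul_le_mul_left _ (Nat.pow_le_pow_left h2 M)
      _ = _ := mul_comm _ _
  have h4 := Nat.le_of_mul_le_mul_left h3 (pow_pos hXpos M)
  rw [show (4 : ℕ) = 2 ^ 2 by norm_num, ← pow_mul] at h4
  exact (Nat.pow_le_pow_iff_right (by norm_num)).mp h4

/-! ### Choice of parameters -/

theorem div_two_mul_le_natDiv {n d : ℕ} (hd : 0 < d) (h : d ≤ n) :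
    (n : ℝ) / (2 * d) ≤ ((n / d : ℕ) : ℝ) := by
  rw [div_le_iff₀ (by positivity)]
  have h1 := Nat.lt_mul_div_succ n hd
  have h2 : 1 ≤ n / d := Nat.div_pos h hd
  have : n ≤ n / d * (2 * d) := by nlinarith
  exact_mod_cast this

theorem space_lower_bound_of_log {n m k s : ℕ} {α : ℝ} (hα : 1 ≤ α) (hlog : 1 ≤ Real.log n)
    (hαn : 1024 * (k + 1) * (α ^ 2 * Real.log n) ≤ n) (hmα : 10 * α ≤ m)
    (hmk : (m : ℝ) ≤ (n : ℝ) ^ (k + 1)) (A : Algorithm n)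
    (hA : A.Estimates m α) (hs : A.UsesAtMost m s) :
    1 / 1024 * ((m : ℝ) * n / α) ≤ s := by
  have hn0 : (0 : ℝ) < n := by
    have : n ≠ 0 := by rintro rfl; norm_num at hlog
    positivity
  obtain ⟨r, hr⟩ : ∃ r, r = ⌊2 * α⌋₊ := ⟨_, rfl⟩
  have hr1 : (r : ℝ) ≤ 2 * α := hr ▸ Nat.floor_le (by linarith)
  have hr2 : 2 * α < r + 1 := hr ▸ Nat.lt_floor_add_one _
  have hr0 : 0 < r := by
    rw [hr, Nat.floor_pos]; linarith
  have hr0' : (0 : ℝ) < r := by exact_mod_cast hr0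
  have hrsq : (r : ℝ) ^ 2 ≤ 4 * α ^ 2 := by nlinarith
  have hk : (0 : ℝ) ≤ k := k.cast_nonneg
  have hαn' : 1024 * α ^ 2 ≤ n := by
    refine le_trans ?_ hαn
    have : 0 ≤ α ^ 2 := sq_nonneg α
    nlinarith [mul_le_mul_of_nonneg_left hlog this, mul_nonneg hk
      (mul_nonneg this (zero_le_one.trans hlog))]
  have hd : 128 * r ^ 2 ≤ n := by
    have : (128 : ℝ) * r ^ 2 ≤ n := by nlinarith [sq_nonneg α]
    exact_mod_cast this
  -- The largest `w` for which the blocks fit into `[n]`.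
  obtain ⟨w, hw⟩ : ∃ w, w = n / (128 * r ^ 2) := ⟨_, rfl⟩
  have hwn : 128 * r ^ 2 * w ≤ n := hw ▸ Nat.mul_div_le _ _
  have hw1 : 1 ≤ w := hw ▸ Nat.div_pos hd (by positivity)
  have hwr : (n : ℝ) / (256 * r ^ 2) ≤ w := by
    have := div_two_mul_le_natDiv (by positivity) hd
    rw [← hw] at this
    refine le_trans (le_of_eq ?_) this
    push_cast; ring
  -- Leaves at least half of the stream for the `M` transversals.
  have hm4 : 4 * r + 2 ≤ m := by
    have : (4 : ℝ) * r + 2 ≤ m := by linarith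
    exact_mod_cast this
  obtain ⟨M, hM⟩ : ∃ M, m = M + (2 * r + 1) := ⟨m - (2 * r + 1), by omega⟩
  have hwlog : (k + 1) * Real.log n ≤ w := by
    refine le_trans ?_ hwr
    rw [le_div_iff₀ (by positivity)]
    have : 0 ≤ (k + 1) * Real.log n := by positivity
    nlinarith [mul_le_mul_of_nonneg_left hrsq this]
  have hM4 : M ≤ 4 ^ w := by
    have h1 : (m : ℝ) ≤ 4 ^ w := by
      calc (m : ℝ) ≤ (n : ℝ) ^ (k + 1) := hmk
        _ = Real.exp ((k + 1) * Real.log n) := by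
            rw [mul_comm, Real.exp_mul, Real.exp_log hn0]; norm_cast
        _ ≤ Real.exp w := Real.exp_le_exp.mpr hwlog
        _ = Real.exp 1 ^ w := by rw [← Real.exp_nat_mul, mul_one]
        _ ≤ 4 ^ w := pow_le_pow_left₀ (Real.exp_pos 1).le
            (Real.exp_one_lt_d9.le.trans (by norm_num)) w
    have h2 : m ≤ 4 ^ w := by exact_mod_cast h1
    omega
  subst hM
  have hM0 : 0 < M := by omega
  have key := space_lower_bound hM0 hr0 hM4 hwn hr2 (by linarith) A hA hs
  -- Absorbs the `+ 1` in `key`.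
  have hpos : 1 ≤ r * w * M := Nat.mul_pos (Nat.mul_pos hr0 hw1) hM0
  have hs' : ((r * w * M : ℕ) : ℝ) ≤ s := by exact_mod_cast (by omega : r * w * M ≤ s)
  refine le_trans ?_ hs'
  have hMm : ((M + (2 * r + 1) : ℕ) : ℝ) / 2 ≤ M := by
    have : M + (2 * r + 1) ≤ 2 * M := by omega
    have : ((M + (2 * r + 1) : ℕ) : ℝ) ≤ 2 * M := by exact_mod_cast this
    linarith
  -- `r * w ≥ n / (256 * r) ≥ n / (512 * α)`, and `M` is at least half of the stream length.
  calc 1 / 1024 * (((M + (2 * r + 1) : ℕ) : ℝ) * n / α)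
      = n / (512 * (2 * α)) * ((M + (2 * r + 1) : ℕ) : ℝ) := by field_simp; norm_num
    _ ≤ n / (512 * r) * ((M + (2 * r + 1) : ℕ) : ℝ) := by gcongr
    _ = r * (n / (256 * r ^ 2)) * (((M + (2 * r + 1) : ℕ) : ℝ) / 2) := by field_simp; norm_num
    _ ≤ r * w * M := by gcongr
    _ = _ := by push_cast; ring

end SetCoverStream

theorem mainTheorem4 :
    ∃ c : ℝ, 0 < c ∧
      ∀ (α : ℕ → ℝ) (m : ℕ → ℕ),
        (∀ n, 1 ≤ α n) →
        α =o[atTop] (fun n : ℕ => Real.sqrt ((n : ℝ) / Real.log (n : ℝ))) →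
        (∃ k : ℕ, (fun n : ℕ => (m n : ℝ)) =O[atTop] (fun n : ℕ => (n : ℝ) ^ k)) →
        (fun n : ℕ => α n * Real.log (n : ℝ)) =O[atTop] (fun n : ℕ => (m n : ℝ)) →
        ∀ᶠ n : ℕ in atTop, ∀ (A : SetCoverStream.Algorithm n) (s : ℕ),
          A.Estimates (m n) (α n) → A.UsesAtMost (m n) s →
            c * ((m n : ℝ) * (n : ℝ) / α n) ≤ (s : ℝ) := by
  refine ⟨1 / 1024, by norm_num, fun α m hα hαo ⟨k, hmk⟩ hmα => ?_⟩
  obtain ⟨C, hC⟩ := hmk.bound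
  obtain ⟨D, hD0, hD⟩ := hmα.exists_pos
  -- Squaring `α ≤ ε √(n / log n)` with this `ε` gives `1024 (k + 1) α² log n ≤ n`.
  have hε : (0 : ℝ) < Real.sqrt (1 / (1024 * (k + 1))) := Real.sqrt_pos.mpr (by positivity)
  have hlogT : Tendsto (fun n : ℕ => Real.log (n : ℝ)) atTop atTop :=
    Real.tendsto_log_atTop.comp tendsto_natCast_atTop_atTop
  -- `log n ≥ 10 * D` turns `α log n ≤ D * m` into `10 * α ≤ m`; `n ≥ C` absorbs `C` into the
  -- exponent `k + 1`.
  filter_upwards [hαo.bound hε, hC, hD.bound, hlogT.eventually_ge_atTop 1,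
    hlogT.eventually_ge_atTop (10 * D), tendsto_natCast_atTop_atTop.eventually_ge_atTop C]
    with n h1 h2 h3 hlog hlogD hnC A s hA hs
  have hαn := hα n
  have hn : (0 : ℝ) ≤ n := n.cast_nonneg
  refine SetCoverStream.space_lower_bound_of_log (k := k) hαn hlog ?_ ?_ ?_ A hA hs
  · rw [Real.norm_of_nonneg (by linarith), Real.norm_of_nonneg (Real.sqrt_nonneg _),
      ← Real.sqrt_mul (by positivity)] at h1
    have h4 := (Real.le_sqrt' (by linarith)).mp h1
    have hlog0 : 0 < Real.log n := by linarith
    calc 1024 * (k + 1) * (α n ^ 2 * Real.log n)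
        ≤ 1024 * (k + 1) * (1 / (1024 * (k + 1)) * (n / Real.log n) * Real.log n) := by gcongr
      _ = n := by field_simp
  · rw [Real.norm_of_nonneg (by positivity), Real.norm_of_nonneg (by positivity)] at h3
    have h4 := mul_le_mul_of_nonneg_left hlogD (by linarith : 0 ≤ α n)
    refine le_of_mul_le_mul_left ?_ hD0
    linarith
  · rw [Real.norm_of_nonneg (by positivity), Real.norm_of_nonneg (by positivity)] at h2
    calc (m n : ℝ) ≤ C * (n : ℝ) ^ k := h2
      _ ≤ n * (n : ℝ) ^ k := by gcongr
      _ = (n : ℝ) ^ (k + 1) := by ring
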